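/- Let $\mathbb R_\bot=\mathbb R\cup\{\bot\}$, where $\bot$ means ``undefined''. $\mathrm{FO(SUM)}$ is first-order logic over finite structures equipped with weight functions into $\mathbb R_\bot$, extended with weight terms \[ t ::= \bot \mid w(s_1,\dots,s_n)\mid r(t,\dots,t)\mid \textsf{if }\varphi\textsf{ then }t\textsf{ else }t\mid \sum_{\bar x:\varphi}t, \] where $w$ is a weight function symbol, the $s_i$ are standard terms, $r$ is a rational function with rational coefficients and $\varphi$ is a formula; weight terms can be compared in formulas by $t_1=t_2$ and $t_1<t_2$. Arithmetic with an argument $\bot$ and division by zero give $\bot$, and $\bot<a$ for all $a\in\mathbb R$. For $m,\ell\ge 1$, let $\mathbf F(m,\ell)$ be the class of layered feedforward networks with $m$ inputs, $\ell-1$ nonempty hidden layers of ReLU nodes and an output layer consisting of a single linear node, in which all edges go from a layer to the next one, edges carry real weights, and non-input nodes carry real biases. Such a network $\mathcal N$ represents a function $F^{\mathcal N}:\mathbb R^m\to\mathbb R$. It is viewed as a finite weighted structure on its set of nodes, with the binary edge relation $E$, constants $\mathrm{in}_1,\dots,\mathrm{in}_m$ and $\mathrm{out}$ for the input nodes and the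 output node, a unary weight function $b$ for the biases ($\bot$ on inputs) and a binary weight function $w$ for the edge weights ($0$ on pairs of nodes without an edge). Then for every $m\ge 1$ the query $F(0)=0$, given by the sentence $F(0,\dots,0)=0$ of first-order logic over the ordered field of reals with an extra $m$-ary function symbol $F$, is not expressible in $\mathrm{FO(SUM)}$ over networks of unbounded depth: there is no closed $\mathrm{FO(SUM)}$ formula $\varphi$ over this vocabulary such that for all $\ell\ge 1$ and all $\mathcal N\in\mathbf F(m,\ell)$, \[ \mathcal N\models\varphi \iff F^{\mathcal N}(0,\dots,0)=0 . \] -/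

import Mathlib

namespace FOSum

open Finset

/-! Lifted reals, weighted vocabularies and weighted structures -/

/-- The lifted reals: the reals with an extra least element `⊥` for undefined values.
Its order and its addition (`⊥ + x = x + ⊥ = ⊥`, hence also finite sums) are those wanted here.
Its multiplication in Mathlib is not the wanted one and is not used. -/
abbrev LReal : Type := WithBot ℝ

/-- A vocabulary with function symbols, relation symbols (those of a first-order language) and
weight function symbols, each with an arity. -/
structure Vocabulary extends FirstOrder.Language.{0, 0} where
  Weights : ℕ → Type

/-- An interpretation of all symbols of a vocabulary on a domain `A`. -/
class WStructure (Υ : Vocabulary) (A : Type) extends Υ.toLanguage.Structure A where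
  wtMap : ∀ {k : ℕ}, Υ.Weights k → (Fin k → A) → LReal

/-- A fraction of two polynomials in `k` variables with rational coefficients. -/
structure RatFun (k : ℕ) where
  num : MvPolynomial (Fin k) ℚ
  den : MvPolynomial (Fin k) ℚ
  den_ne_zero : den ≠ 0

open Classical in
/-- The value of a rational function on lifted reals: it is undefined if some argument is undefined
or if there is a division by zero. -/
noncomputable def RatFun.eval {k : ℕ} (r : RatFun k) (a : Fin k → LReal) : LReal :=
  if ∃ i, a i = ⊥ then ⊥
  else
    let x : Fin k → ℝ := fun i => (a i).unbotD 0
    if MvPolynomial.aeval x r.den = 0 then ⊥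
    else ((MvPolynomial.aeval x r.num / MvPolynomial.aeval x r.den : ℝ) : LReal)

/-! Syntax and semantics of the logic. The index `n` is the number of variables that may occur
free; they are numbered from `0` to `n - 1`. A quantifier binds variable number `n` of its body,
and a sum over a `k`-tuple of variables binds the variables `n, …, n + k - 1`. -/

mutual

/-- Formulas with free variables among `n` variables. -/
inductive Formula (Υ : Vocabulary) : ℕ → Type
  | eq {n : ℕ} (s₁ s₂ : Υ.toLanguage.Term (Fin n)) : Formula Υ n
  | rel {n k : ℕ} (R : Υ.Relations k) (s : Fin k → Υ.toLanguage.Term (Fin n)) : Formula Υ n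
  | wtEq {n : ℕ} (t₁ t₂ : WTerm Υ n) : Formula Υ n
  | wtLt {n : ℕ} (t₁ t₂ : WTerm Υ n) : Formula Υ n
  | neg {n : ℕ} (φ : Formula Υ n) : Formula Υ n
  | conj {n : ℕ} (φ ψ : Formula Υ n) : Formula Υ n
  | disj {n : ℕ} (φ ψ : Formula Υ n) : Formula Υ n
  | ex {n : ℕ} (φ : Formula Υ (n + 1)) : Formula Υ n
  | all {n : ℕ} (φ : Formula Υ (n + 1)) : Formula Υ n

/-- Weight terms with free variables among `n` variables. -/
inductive WTerm (Υ : Vocabulary) : ℕ → Type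
  | undef {n : ℕ} : WTerm Υ n
  | wt {n k : ℕ} (w : Υ.Weights k) (s : Fin k → Υ.toLanguage.Term (Fin n)) : WTerm Υ n
  | rat {n k : ℕ} (r : RatFun k) (t : Fin k → WTerm Υ n) : WTerm Υ n
  | ite {n : ℕ} (φ : Formula Υ n) (t₁ t₂ : WTerm Υ n) : WTerm Υ n
  | sum {n : ℕ} (k : ℕ) (φ : Formula Υ (n + k)) (t : WTerm Υ (n + k)) : WTerm Υ n

end

section Semantics

open Classical

variable {Υ : Vocabulary} {A : Type} [WStructure Υ A] [Fintype A]

mutual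

/-- Satisfaction of a formula under an assignment of domain elements to the variables. -/
noncomputable def Formula.Holds {n : ℕ} (φ : Formula Υ n) (v : Fin n → A) : Prop :=
  match φ with
  | .eq s₁ s₂ => s₁.realize v = s₂.realize v
  | .rel R s => FirstOrder.Language.Structure.RelMap R (fun i => (s i).realize v)
  | .wtEq t₁ t₂ => t₁.eval v = t₂.eval v
  | .wtLt t₁ t₂ => t₁.eval v < t₂.eval v
  | .neg φ => ¬ φ.Holds v
  | .conj φ ψ => φ.Holds v ∧ ψ.Holds v
  | .disj φ ψ => φ.Holds v ∨ ψ.Holds v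
  | .ex φ => ∃ a : A, φ.Holds (Fin.snoc (α := fun _ => A) v a)
  | .all φ => ∀ a : A, φ.Holds (Fin.snoc (α := fun _ => A) v a)

/-- The value of a weight term under an assignment of domain elements to the variables. -/
noncomputable def WTerm.eval {n : ℕ} (t : WTerm Υ n) (v : Fin n → A) : LReal :=
  match t with
  | .undef => ⊥
  | .wt w s => WStructure.wtMap w (fun i => (s i).realize v)
  | .rat r t => r.eval (fun i => (t i).eval v)
  | .ite φ t₁ t₂ => if φ.Holds v then t₁.eval v else t₂.eval v
  | .sum k φ t => ∑ b : Fin k → A with φ.Holds (Fin.append v b), t.eval (Fin.append v b)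

end

end Semantics

/-- Closed formulas. -/
abbrev ClosedFormula (Υ : Vocabulary) : Type := Formula Υ 0

/-- Truth of a closed formula in a finite weighted structure. -/
def Models {Υ : Vocabulary} (A : Type) [WStructure Υ A] [Fintype A] (φ : ClosedFormula Υ) : Prop :=
  φ.Holds (Fin.elim0 : Fin 0 → A)

/-! Neural networks -/

/-- Feedforward neural networks with `m` inputs and `n` outputs: finite acyclic directed graphs with
a weight on every edge and a bias on every node that is not an input. (Only these values of `weight`
and `bias` are ever used.) Inputs are source nodes and outputs are sink nodes. -/
structure ReLUFNN (m n : ℕ) where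
  Node : Type
  [fintypeNode : Fintype Node]
  Edge : Node → Node → Prop
  acyclic : ∀ u, ¬ Relation.TransGen Edge u u
  inp : Fin m → Node
  out : Fin n → Node
  inp_injective : Function.Injective inp
  out_injective : Function.Injective out
  inp_ne_out : ∀ i j, inp i ≠ out j
  inp_source : ∀ i u, ¬ Edge u (inp i)
  out_sink : ∀ j u, ¬ Edge (out j) u
  weight : Node → Node → ℝ
  bias : Node → ℝ

namespace ReLUFNN

variable {m n : ℕ}

instance (N : ReLUFNN m n) : Fintype N.Node := N.fintypeNode

theorem wellFounded_edge (N : ReLUFNN m n) : WellFounded N.Edge := by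
  have : Std.Irrefl (Relation.TransGen N.Edge) := ⟨N.acyclic⟩
  exact Subrelation.wf (fun h => Relation.TransGen.single h)
    (Finite.wellFounded_of_trans_of_irrefl (Relation.TransGen N.Edge))

open Classical in
/-- The value at node `u` on the input vector `x`, by recursion along the edges: the `i`-th coordinate
of `x` at the `i`-th input; bias plus weighted sum over the predecessors at an output; and the ReLU
of the same expression at a hidden node. -/
noncomputable def nodeFun (N : ReLUFNN m n) (x : Fin m → ℝ) : N.Node → ℝ :=
  N.wellFounded_edge.fix fun u rec =>
    if h : ∃ i, N.inp i = u then x h.choose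
    else
      let z : ℝ := N.bias u + ∑ v : {v // N.Edge v u}, N.weight v u * rec v v.2
      if ∃ j, N.out j = u then z else max 0 z

/-- The function from `ℝ^m` to `ℝ^n` represented by a network. -/
noncomputable def func (N : ReLUFNN m n) (x : Fin m → ℝ) : Fin n → ℝ :=
  fun j => N.nodeFun x (N.out j)

/-- The network is layered with depth `ℓ`: layer `0` consists of the inputs, layer `ℓ` consists of
the outputs, the hidden nodes form the nonempty layers `1, …, ℓ - 1`, and all edges go from a layer
to the next one. -/
def IsLayered (N : ReLUFNN m n) (ℓ : ℕ) : Prop :=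
  ∃ layer : N.Node → ℕ,
    (∀ u, layer u = 0 ↔ ∃ i, N.inp i = u) ∧
    (∀ u, layer u = ℓ ↔ ∃ j, N.out j = u) ∧
    (∀ u, layer u ≤ ℓ) ∧
    (∀ i, 1 ≤ i → i < ℓ → ∃ u, layer u = i) ∧
    (∀ u v, N.Edge u v → layer v = layer u + 1)

end ReLUFNN

/-- The class of layered networks of depth `ℓ` with `m` inputs and a single output. -/
def LayeredNets (m ℓ : ℕ) : Set (ReLUFNN m 1) := {N | N.IsLayered ℓ}

/-! Networks as weighted structures -/

/-- Constant symbols for the input and the output nodes. -/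
inductive NetFun (m n : ℕ) : ℕ → Type
  | inp (i : Fin m) : NetFun m n 0
  | out (j : Fin n) : NetFun m n 0

/-- The binary relation symbol for the edges. -/
inductive NetRel : ℕ → Type
  | edge : NetRel 2

/-- The weight function symbols for the biases and for the edge weights. -/
inductive NetWt : ℕ → Type
  | bias : NetWt 1
  | weight : NetWt 2

/-- The vocabulary of neural networks with `m` inputs and `n` outputs. -/
def netVocabulary (m n : ℕ) : Vocabulary where
  Functions := NetFun m n
  Relations := NetRel
  Weights := NetWt

open Classical in
/-- A network as a weighted structure on its nodes. The bias of an input is undefined, and the weight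
between two nodes without an edge is `0`. -/
noncomputable instance netStructure {m n : ℕ} (N : ReLUFNN m n) :
    WStructure (netVocabulary m n) N.Node where
  funMap {_} f _ :=
    match f with
    | NetFun.inp i => N.inp i
    | NetFun.out j => N.out j
  RelMap {_} R :=
    match R with
    | NetRel.edge => fun a => N.Edge (a 0) (a 1)
  wtMap {_} w :=
    match w with
    | NetWt.bias => fun a => if ∃ i, N.inp i = a 0 then ⊥ else ((N.bias (a 0) : ℝ) : LReal)
    | NetWt.weight => fun a =>
        if N.Edge (a 0) (a 1) then ((N.weight (a 0) (a 1) : ℝ) : LReal) else ((0 : ℝ) : LReal)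

/-! First-order logic over the reals with an extra function symbol -/

/-- The function symbols of elementary arithmetic and an extra `m`-ary function symbol `F`. -/
inductive RealFun (m : ℕ) : ℕ → Type
  | zero : RealFun m 0
  | one : RealFun m 0
  | add : RealFun m 2
  | mul : RealFun m 2
  | F : RealFun m m

/-- The order symbol. -/
inductive RealRel : ℕ → Type
  | lt : RealRel 2

/-- The language of first-order logic over the reals with an extra function symbol `F`. -/
def realLanguage (m : ℕ) : FirstOrder.Language.{0, 0} where
  Functions := RealFun m
  Relations := RealRel

/-- The reals with their arithmetic, where `F` is interpreted by `f`. -/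
@[reducible] noncomputable def realStructure {m : ℕ} (f : (Fin m → ℝ) → ℝ) :
    (realLanguage m).Structure ℝ where
  funMap {_} s :=
    match s with
    | RealFun.zero => fun _ => 0
    | RealFun.one => fun _ => 1
    | RealFun.add => fun a => a 0 + a 1
    | RealFun.mul => fun a => a 0 * a 1
    | RealFun.F => f
  RelMap {_} R :=
    match R with
    | RealRel.lt => fun a => a 0 < a 1

/-- Truth of a sentence in the reals expanded by `f`. -/
def RealModels {m : ℕ} (f : (Fin m → ℝ) → ℝ) (ψ : (realLanguage m).Sentence) : Prop :=
  letI := realStructure f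
  ψ.Realize ℝ

/-- The sentence `F(0, …, 0) = 0`. -/
def zeroAtZero (m : ℕ) : (realLanguage m).Sentence :=
  let zero : (realLanguage m).Term Empty :=
    FirstOrder.Language.Term.func (L := realLanguage m) (l := 0) RealFun.zero Fin.elim0
  (FirstOrder.Language.Term.func (L := realLanguage m) (l := m) RealFun.F fun _ => zero).equal zero

/-- The black-box query given by `ψ` is expressible by a single closed formula over the vocabulary of
networks, on the networks of all depths with `m` inputs and one output. -/
def ExpressibleInFOSum {m : ℕ} (ψ : (realLanguage m).Sentence) : Prop :=
  ∃ φ : ClosedFormula (netVocabulary m 1),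
    ∀ ℓ : ℕ, 1 ≤ ℓ → ∀ N ∈ LayeredNets m ℓ,
      (RealModels (fun x => N.func x 0) ψ ↔ Models N.Node φ)

end FOSum

/-! The proof is a locality argument. Two structures are compared by a bijective game: in every round
the second player presents a bijection of the two domains, the first player picks an element, and
the picked element and its image are added to the tuples, which have to satisfy the same atomic
formulas and have the same weights. Equality of weights is equality of lifted reals, so arithmetic
on weight terms needs no analysis, and the bijection of a round reindexes a sum over one variable.
Hence every formula is preserved by the game with some number `r` of rounds, which does not depend
on the structures (`Formula.exists_rounds`, `WTerm.exists_rounds`).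

The networks `chainNet m L b`, for `b = true` and `b = false`, consist of two parallel chains of `L`
hidden nodes, only one of which (the chain `true`) leads to the output. The chain `b` starts with
bias `1`, all other biases are `0`, and all edge weights are `1`. At the origin the bias is
transported along its chain, so the value is `1` if `b = true` and `0` if `b = false`. Exchanging
the two chains up to some layer maps one network to the other, except that the edges out of this
layer are not respected. The second player can keep this faulty layer away from all chosen nodes
for `r` rounds if `L ≥ 2 ^ (r + 1)`, by halving the free gap in each round (`bijEquiv_of_matched`).
So a formula cannot distinguish the two networks once `L` is large. -/

namespace FOSum

/-! ### Bijective games -/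

section Game

variable {Υ : Vocabulary} {A B : Type} [WStructure Υ A] [WStructure Υ B]

/-- Two tuples satisfy the same atomic formulas, and weight symbols take the same value (as lifted
reals) on corresponding tuples of terms. -/
structure AtomEquiv (Υ : Vocabulary) {A B : Type} [WStructure Υ A] [WStructure Υ B] {n : ℕ}
    (v : Fin n → A) (w : Fin n → B) : Prop where
  eq_iff : ∀ s₁ s₂ : Υ.toLanguage.Term (Fin n),
    s₁.realize v = s₂.realize v ↔ s₁.realize w = s₂.realize w
  rel_iff : ∀ {k : ℕ} (R : Υ.Relations k) (s : Fin k → Υ.toLanguage.Term (Fin n)),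
    FirstOrder.Language.Structure.RelMap R (fun i => (s i).realize v) ↔
      FirstOrder.Language.Structure.RelMap R (fun i => (s i).realize w)
  wt_eq : ∀ {k : ℕ} (W : Υ.Weights k) (s : Fin k → Υ.toLanguage.Term (Fin n)),
    WStructure.wtMap W (fun i => (s i).realize v) = WStructure.wtMap W (fun i => (s i).realize w)

/-- The second player wins the `r`-round bijective game from the position `(v, w)`: in each round
that player chooses a bijection `f` of the domains, the first player chooses an element `a`, and the
tuples are extended by `a` and `f a`; they have to agree atomically throughout. -/
def BijEquiv (Υ : Vocabulary) {A B : Type} [WStructure Υ A] [WStructure Υ B] :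
    ℕ → ∀ {n : ℕ}, (Fin n → A) → (Fin n → B) → Prop
  | 0, _, v, w => AtomEquiv Υ v w
  | r + 1, _, v, w => AtomEquiv Υ v w ∧ ∃ f : A ≃ B, ∀ a,
      BijEquiv Υ r (Fin.snoc (α := fun _ => A) v a) (Fin.snoc (α := fun _ => B) w (f a))

theorem BijEquiv.atomEquiv {r n : ℕ} {v : Fin n → A} {w : Fin n → B} (h : BijEquiv Υ r v w) :
    AtomEquiv Υ v w := by
  cases r with
  | zero => exact h
  | succ r => exact h.1

theorem BijEquiv.of_succ {r n : ℕ} {v : Fin n → A} {w : Fin n → B} (h : BijEquiv Υ (r + 1) v w) :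
    BijEquiv Υ r v w := by
  induction r generalizing n with
  | zero => exact h.1
  | succ r ih => exact ⟨h.1, h.2.imp fun f hf a => ih (hf a)⟩

theorem BijEquiv.mono {r s n : ℕ} (hrs : r ≤ s) {v : Fin n → A} {w : Fin n → B}
    (h : BijEquiv Υ s v w) : BijEquiv Υ r v w := by
  induction s, hrs using Nat.le_induction with
  | base => exact h
  | succ s _ ih => exact ih h.of_succ

/-- Summing over one more variable costs one round: the bijection of that round reindexes the sum.
Hence a sum over a `k`-tuple costs `k` rounds. -/
theorem BijEquiv.sum_eq [Fintype A] [Fintype B] {M : Type*} [AddCommMonoid M] {k r n : ℕ}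
    {v : Fin n → A} {w : Fin n → B} (h : BijEquiv Υ (r + k) v w)
    (g : (Fin (n + k) → A) → M) (g' : (Fin (n + k) → B) → M)
    (hg : ∀ v' w', BijEquiv Υ r v' w' → g v' = g' w') :
    ∑ b : Fin k → A, g (Fin.append v b) = ∑ b : Fin k → B, g' (Fin.append w b) := by
  induction k generalizing r with
  | zero =>
    have hv : ∀ b : Fin 0 → A, Fin.append v b = v := fun b => by
      funext i; exact Fin.append_left v b i
    have hw : ∀ b : Fin 0 → B, Fin.append w b = w := fun b => by
      funext i; exact Fin.append_left w b i
    simp [hv, hw, hg v w h]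
  | succ k ih =>
    have key : ∀ {C : Type} [Fintype C] (u : Fin n → C) (p : (Fin (n + (k + 1)) → C) → M),
        ∑ b : Fin (k + 1) → C, p (Fin.append u b) =
          ∑ b : Fin k → C, ∑ c : C, p (Fin.snoc (α := fun _ => C) (Fin.append u b) c) := by
      intro C _ u p
      rw [← (Fin.snocEquiv (fun _ : Fin (k + 1) => C)).sum_comp, Fintype.sum_prod_type_right]
      refine Finset.sum_congr rfl fun b _ => Finset.sum_congr rfl fun c _ => ?_
      exact congrArg p (Fin.append_snoc u b c)
    rw [key, key]
    refine ih (r := r + 1) (by rwa [Nat.add_right_comm])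
      (fun u => ∑ c, g (Fin.snoc (α := fun _ => A) u c))
      (fun u => ∑ c, g' (Fin.snoc (α := fun _ => B) u c)) fun v' w' h' => ?_
    obtain ⟨-, f, hf⟩ := h'
    rw [← f.sum_comp]
    exact Finset.sum_congr rfl fun a _ => hg _ _ (hf a)

end Game

mutual

/-- Every formula is preserved by the bijective game with sufficiently many rounds. The number of
rounds does not depend on the structures. -/
theorem Formula.exists_rounds {Υ : Vocabulary} {n : ℕ} (φ : Formula Υ n) :
    ∃ r : ℕ, ∀ (A B : Type) [WStructure Υ A] [WStructure Υ B] [Fintype A] [Fintype B]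
      (v : Fin n → A) (w : Fin n → B), BijEquiv Υ r v w → (φ.Holds v ↔ φ.Holds w) := by
  match φ with
  | .eq s₁ s₂ =>
    refine ⟨0, fun A B _ _ _ _ v w h => ?_⟩
    simpa only [Formula.Holds] using h.atomEquiv.eq_iff s₁ s₂
  | .rel R s =>
    refine ⟨0, fun A B _ _ _ _ v w h => ?_⟩
    simpa only [Formula.Holds] using h.atomEquiv.rel_iff R s
  | .wtEq t₁ t₂ =>
    obtain ⟨r₁, h₁⟩ := WTerm.exists_rounds t₁
    obtain ⟨r₂, h₂⟩ := WTerm.exists_rounds t₂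
    refine ⟨max r₁ r₂, fun A B _ _ _ _ v w h => ?_⟩
    simp only [Formula.Holds, h₁ A B v w (h.mono (le_max_left _ _)),
      h₂ A B v w (h.mono (le_max_right _ _))]
  | .wtLt t₁ t₂ =>
    obtain ⟨r₁, h₁⟩ := WTerm.exists_rounds t₁
    obtain ⟨r₂, h₂⟩ := WTerm.exists_rounds t₂
    refine ⟨max r₁ r₂, fun A B _ _ _ _ v w h => ?_⟩
    simp only [Formula.Holds, h₁ A B v w (h.mono (le_max_left _ _)),
      h₂ A B v w (h.mono (le_max_right _ _))]
  | .neg φ =>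
    obtain ⟨r, hr⟩ := Formula.exists_rounds φ
    refine ⟨r, fun A B _ _ _ _ v w h => ?_⟩
    simp only [Formula.Holds, hr A B v w h]
  | .conj φ ψ =>
    obtain ⟨r₁, h₁⟩ := Formula.exists_rounds φ
    obtain ⟨r₂, h₂⟩ := Formula.exists_rounds ψ
    refine ⟨max r₁ r₂, fun A B _ _ _ _ v w h => ?_⟩
    simp only [Formula.Holds, h₁ A B v w (h.mono (le_max_left _ _)),
      h₂ A B v w (h.mono (le_max_right _ _))]
  | .disj φ ψ =>
    obtain ⟨r₁, h₁⟩ := Formula.exists_rounds φ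
    obtain ⟨r₂, h₂⟩ := Formula.exists_rounds ψ
    refine ⟨max r₁ r₂, fun A B _ _ _ _ v w h => ?_⟩
    simp only [Formula.Holds, h₁ A B v w (h.mono (le_max_left _ _)),
      h₂ A B v w (h.mono (le_max_right _ _))]
  | .ex φ =>
    obtain ⟨r, hr⟩ := Formula.exists_rounds φ
    refine ⟨r + 1, fun A B _ _ _ _ v w h => ?_⟩
    obtain ⟨-, f, hf⟩ := h
    simp only [Formula.Holds]
    exact f.exists_congr fun a => hr A B _ _ (hf a)
  | .all φ =>
    obtain ⟨r, hr⟩ := Formula.exists_rounds φ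
    refine ⟨r + 1, fun A B _ _ _ _ v w h => ?_⟩
    obtain ⟨-, f, hf⟩ := h
    simp only [Formula.Holds]
    exact f.forall_congr fun a => hr A B _ _ (hf a)

/-- The value of a weight term is preserved by the bijective game with sufficiently many rounds. -/
theorem WTerm.exists_rounds {Υ : Vocabulary} {n : ℕ} (t : WTerm Υ n) :
    ∃ r : ℕ, ∀ (A B : Type) [WStructure Υ A] [WStructure Υ B] [Fintype A] [Fintype B]
      (v : Fin n → A) (w : Fin n → B), BijEquiv Υ r v w → t.eval v = t.eval w := by
  match t with
  | .undef =>
    refine ⟨0, fun A B _ _ _ _ v w h => ?_⟩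
    simp only [WTerm.eval]
  | .wt W s =>
    refine ⟨0, fun A B _ _ _ _ v w h => ?_⟩
    simpa only [WTerm.eval] using h.atomEquiv.wt_eq W s
  | .rat q t =>
    choose r hr using fun i => WTerm.exists_rounds (t i)
    refine ⟨Finset.univ.sup r, fun A B _ _ _ _ v w h => ?_⟩
    simp only [WTerm.eval]
    exact congrArg q.eval (funext fun i =>
      hr i A B v w (h.mono (Finset.le_sup (Finset.mem_univ i))))
  | .ite φ t₁ t₂ =>
    obtain ⟨r₀, h₀⟩ := Formula.exists_rounds φ
    obtain ⟨r₁, h₁⟩ := WTerm.exists_rounds t₁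
    obtain ⟨r₂, h₂⟩ := WTerm.exists_rounds t₂
    refine ⟨max r₀ (max r₁ r₂), fun A B _ _ _ _ v w h => ?_⟩
    classical
    simp only [WTerm.eval]
    exact if_congr (h₀ A B v w (h.mono (by simp))) (h₁ A B v w (h.mono (by simp)))
      (h₂ A B v w (h.mono (by simp)))
  | .sum k φ t =>
    obtain ⟨r₁, h₁⟩ := Formula.exists_rounds φ
    obtain ⟨r₂, h₂⟩ := WTerm.exists_rounds t
    refine ⟨max r₁ r₂ + k, fun A B _ _ _ _ v w h => ?_⟩
    classical
    simp only [WTerm.eval, Finset.sum_filter]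
    refine h.sum_eq (fun v' => if φ.Holds v' then t.eval v' else 0)
      (fun w' => if φ.Holds w' then t.eval w' else 0) fun v' w' h' => ?_
    simp only [h₁ A B v' w' (h'.mono (le_max_left _ _)),
      h₂ A B v' w' (h'.mono (le_max_right _ _))]

end

/-! ### The two-chain networks -/

/-- The nodes of a network with two parallel chains of `L` hidden nodes, named `true` and `false`. -/
inductive ChainNode (m L : ℕ) : Type
  | inp (i : Fin m)
  | hid (i : Fin L) (c : Bool)
  | out
  deriving Fintype

namespace ChainNode

variable {m L : ℕ}

/-- The layer of a node. -/
def layer : ChainNode m L → ℕ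
  | inp _ => 0
  | hid i _ => i + 1
  | out => L + 1

/-- The edges go from every input to the first node of both chains, along the chains, and from the
last node of the chain `true` to the output. -/
def Edge : ChainNode m L → ChainNode m L → Prop
  | inp _, hid i _ => (i : ℕ) = 0
  | hid i c, hid j d => (j : ℕ) = i + 1 ∧ c = d
  | hid i c, out => (i : ℕ) + 1 = L ∧ c = true
  | _, _ => False

/-- The bias is `1` at the first node of the chain `b` and `0` elsewhere. -/
def bias (b : Bool) : ChainNode m L → ℝ
  | hid i c => if (i : ℕ) = 0 ∧ c = b then 1 else 0
  | _ => 0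

/-- Exchange the two chains. -/
def flip : ChainNode m L → ChainNode m L
  | hid i c => hid i !c
  | u => u

@[simp] theorem flip_flip (u : ChainNode m L) : u.flip.flip = u := by
  cases u <;> simp [flip]

@[simp] theorem layer_flip (u : ChainNode m L) : u.flip.layer = u.layer := by
  cases u <;> rfl

theorem layer_eq_of_edge {u v : ChainNode m L} (h : Edge u v) : v.layer = u.layer + 1 := by
  cases u <;> cases v <;> simp_all [Edge, layer]

/-- Exchanging the chains respects the edges except those into the output, which come from the chain
`true` only. -/
theorem edge_flip_iff {u v : ChainNode m L} (hv : v.layer ≤ L) :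
    Edge u.flip v.flip ↔ Edge u v := by
  cases u <;> cases v <;> simp_all [Edge, layer, flip]

theorem bias_flip (b : Bool) (u : ChainNode m L) : bias (!b) u.flip = bias b u := by
  cases u <;> simp [bias, flip]

theorem bias_eq_zero (b : Bool) {u : ChainNode m L} (hu : 2 ≤ u.layer) : bias b u = 0 := by
  cases u <;> simp_all [bias, layer]
  omega

/-- Exchange the two chains in the layers up to `c`. This respects all edges except those from layer
`c` to layer `c + 1`. -/
def flipUpTo (c : ℕ) : Equiv.Perm (ChainNode m L) :=
  Function.Involutive.toPerm (fun u => if u.layer ≤ c then u.flip else u) fun u => by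
    by_cases h : u.layer ≤ c <;> simp [h]

end ChainNode

open ChainNode in
/-- The two-chain network with all edge weights `1` whose chain `b` starts with bias `1`. -/
def chainNet (m L : ℕ) (b : Bool) : ReLUFNN m 1 where
  Node := ChainNode m L
  Edge := Edge
  acyclic u h := by
    have : ∀ v, Relation.TransGen Edge u v → u.layer < v.layer := fun v hv => by
      induction hv with
      | single h => have := layer_eq_of_edge h; omega
      | tail _ h ih => have := layer_eq_of_edge h; omega
    exact lt_irrefl _ (this u h)
  inp := inp
  out _ := out
  inp_injective _ _ h := by simpa using h
  out_injective _ _ _ := Subsingleton.elim _ _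
  inp_ne_out _ _ := by simp
  inp_source _ u := by cases u <;> simp [Edge]
  out_sink _ u := by cases u <;> simp [Edge]
  weight _ _ := 1
  bias := bias b

theorem chainNet_mem_layeredNets (m L : ℕ) (b : Bool) :
    chainNet m L b ∈ LayeredNets m (L + 1) := by
  refine ⟨ChainNode.layer, fun u => ?_, fun u => ?_, fun u => ?_, fun i h₁ h₂ => ?_,
    fun u v h => ChainNode.layer_eq_of_edge h⟩
  · cases u <;> simp [chainNet, ChainNode.layer]
  · cases u with
    | hid i c => simpa [chainNet, ChainNode.layer] using i.2.ne
    | _ => simp [chainNet, ChainNode.layer]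
  · cases u <;> simp [ChainNode.layer]
  · exact ⟨.hid ⟨i - 1, by omega⟩ true, by simp [ChainNode.layer]; omega⟩

/-! ### The value at the origin -/

section NodeFun

variable {m n : ℕ} (N : ReLUFNN m n) (x : Fin m → ℝ)

theorem ReLUFNN.nodeFun_inp (i : Fin m) : N.nodeFun x (N.inp i) = x i := by
  have h : ∃ j, N.inp j = N.inp i := ⟨i, rfl⟩
  rw [ReLUFNN.nodeFun, WellFounded.fix_eq, dif_pos h, N.inp_injective h.choose_spec]

open Classical in
theorem ReLUFNN.nodeFun_of_ne_inp {u : N.Node} (hu : ¬ ∃ i, N.inp i = u) :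
    N.nodeFun x u =
      if ∃ j, N.out j = u then
        N.bias u + ∑ v with N.Edge v u, N.weight v u * N.nodeFun x v
      else max 0 (N.bias u + ∑ v with N.Edge v u, N.weight v u * N.nodeFun x v) := by
  have hs : ∑ v : {v // N.Edge v u}, N.weight v u * N.nodeFun x v =
      ∑ v with N.Edge v u, N.weight v u * N.nodeFun x v :=
    (Finset.sum_subtype _ (by simp) fun v => N.weight v u * N.nodeFun x v).symm
  rw [← hs, ReLUFNN.nodeFun, WellFounded.fix_eq, dif_neg hu]

theorem ReLUFNN.nodeFun_out_of_unique_pred {j : Fin n} {p : N.Node}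
    (hp : ∀ v, N.Edge v (N.out j) ↔ v = p) :
    N.nodeFun x (N.out j) = N.bias (N.out j) + N.weight p (N.out j) * N.nodeFun x p := by
  classical
  have hu : ¬ ∃ i, N.inp i = N.out j := fun ⟨i, hi⟩ => N.inp_ne_out i j hi
  have hs : Finset.univ.filter (fun v => N.Edge v (N.out j)) = {p} := by ext v; simp [hp]
  rw [N.nodeFun_of_ne_inp x hu, if_pos ⟨j, rfl⟩, hs, Finset.sum_singleton]

theorem ReLUFNN.nodeFun_of_unique_pred {u p : N.Node} (hu : ∀ i, N.inp i ≠ u)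
    (hu' : ∀ j, N.out j ≠ u) (hp : ∀ v, N.Edge v u ↔ v = p) :
    N.nodeFun x u = max 0 (N.bias u + N.weight p u * N.nodeFun x p) := by
  classical
  have hs : Finset.univ.filter (fun v => N.Edge v u) = {p} := by ext v; simp [hp]
  rw [N.nodeFun_of_ne_inp x (by simpa using hu), if_neg (by simpa using hu'), hs,
    Finset.sum_singleton]

end NodeFun

section Value

variable {m L : ℕ} (b : Bool)

theorem chainNet_nodeFun_hid (i : ℕ) (hi : i < L) (c : Bool) :
    (chainNet m L b).nodeFun 0 (ChainNode.hid ⟨i, hi⟩ c) = if c = b then 1 else 0 := by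
  classical
  have hinp : ∀ i j, (chainNet m L b).inp j ≠ ChainNode.hid i c := by simp [chainNet]
  have hout : ∀ i j, (chainNet m L b).out j ≠ ChainNode.hid i c := by simp [chainNet]
  induction i with
  | zero =>
    refine ((chainNet m L b).nodeFun_of_ne_inp 0 (not_exists.2 (hinp _))).trans ?_
    rw [if_neg (not_exists.2 (hout _)), Finset.sum_eq_zero]
    · by_cases h : c = b <;> simp [chainNet, ChainNode.bias, h]
    · intro v hv
      replace hv : ChainNode.Edge v (ChainNode.hid ⟨0, hi⟩ c) := (Finset.mem_filter.1 hv).2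
      cases v with
      | inp j => exact mul_eq_zero_of_right _ ((chainNet m L b).nodeFun_inp 0 j)
      | _ => simp [ChainNode.Edge] at hv
  | succ i ih =>
    have hp : ∀ v : ChainNode m L, v.Edge (.hid ⟨i + 1, hi⟩ c) ↔ v = .hid ⟨i, by omega⟩ c := by
      intro v
      cases v <;> simp [ChainNode.Edge, Fin.ext_iff, eq_comm]
    refine ((chainNet m L b).nodeFun_of_unique_pred 0 (hinp _) (hout _) hp).trans ?_
    rw [ih (by omega)]
    by_cases h : c = b <;> simp [chainNet, ChainNode.bias, h]

theorem chainNet_func_zero (hL : 1 ≤ L) :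
    (chainNet m L b).func 0 0 = if true = b then 1 else 0 := by
  have hp : ∀ v : ChainNode m L, v.Edge .out ↔ v = .hid ⟨L - 1, by omega⟩ true := by
    intro v
    cases v <;> simp [ChainNode.Edge, Fin.ext_iff]
    omega
  refine ((chainNet m L b).nodeFun_out_of_unique_pred 0 (j := 0) hp).trans ?_
  rw [chainNet_nodeFun_hid]
  simp [chainNet, ChainNode.bias]

end Value

/-! ### Winning the game on the two-chain networks -/

section Strategy

variable {m L : ℕ}

/-- Corresponding nodes in a game position where the chains are exchanged up to layer `lo` and not
exchanged from layer `hi` on. No node strictly between these layers has been chosen. -/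
def Matched (lo hi : ℕ) (u u' : ChainNode m L) : Prop :=
  (u.layer ≤ lo ∧ u' = u.flip) ∨ (hi ≤ u.layer ∧ u' = u)

variable {lo hi : ℕ} {u u' v v' : ChainNode m L}

theorem Matched.layer_eq (h : Matched lo hi u u') : u'.layer = u.layer := by
  rcases h with ⟨-, rfl⟩ | ⟨-, rfl⟩ <;> simp

theorem Matched.mono {lo' hi' : ℕ} (hlo : lo ≤ lo') (hhi : hi' ≤ hi) (h : Matched lo hi u u') :
    Matched lo' hi' u u' :=
  h.imp (fun h => ⟨h.1.trans hlo, h.2⟩) fun h => ⟨hhi.trans h.1, h.2⟩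

theorem Matched.eq_iff (hlt : lo < hi) (hu : Matched lo hi u u') (hv : Matched lo hi v v') :
    u = v ↔ u' = v' := by
  have e₁ := hu.layer_eq
  have e₂ := hv.layer_eq
  rcases hu with ⟨h₁, rfl⟩ | ⟨h₁, rfl⟩ <;> rcases hv with ⟨h₂, rfl⟩ | ⟨h₂, rfl⟩
  · exact ⟨congrArg _, fun h => by simpa using congrArg ChainNode.flip h⟩
  · constructor <;> intro h <;> have e := congrArg ChainNode.layer h <;> omega
  · constructor <;> intro h <;> have e := congrArg ChainNode.layer h <;> omega
  · rfl

theorem Matched.edge_iff (hlt : lo + 2 ≤ hi) (hhi : hi ≤ L + 1) (hu : Matched lo hi u u')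
    (hv : Matched lo hi v v') : ChainNode.Edge u v ↔ ChainNode.Edge u' v' := by
  have e₁ := hu.layer_eq
  have e₂ := hv.layer_eq
  rcases hu with ⟨h₁, rfl⟩ | ⟨h₁, rfl⟩ <;> rcases hv with ⟨h₂, rfl⟩ | ⟨h₂, rfl⟩
  · exact (ChainNode.edge_flip_iff (by omega)).symm
  · constructor <;> intro h <;> have := ChainNode.layer_eq_of_edge h <;> omega
  · constructor <;> intro h <;> have := ChainNode.layer_eq_of_edge h <;> omega
  · rfl

theorem Matched.bias_eq (hlt : lo + 2 ≤ hi) (b : Bool) (hu : Matched lo hi u u') :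
    u.bias b = u'.bias (!b) := by
  rcases hu with ⟨h₁, rfl⟩ | ⟨h₁, rfl⟩
  · exact (ChainNode.bias_flip b u).symm
  · rw [ChainNode.bias_eq_zero _ (by omega), ChainNode.bias_eq_zero _ (by omega)]

theorem Matched.inp_iff (hu : Matched lo hi u u') :
    (∃ i, ChainNode.inp i = u) ↔ ∃ i, ChainNode.inp i = u' := by
  rcases hu with ⟨-, rfl⟩ | ⟨-, rfl⟩
  · cases u <;> simp [ChainNode.flip]
  · rfl

/-- All function symbols are constants, and these denote matched nodes as well: inputs lie in
layer `0 ≤ lo` and are fixed by the exchange, the output lies in layer `L + 1 ≥ hi`. -/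
theorem Matched.realize (b b' : Bool) {n : ℕ} (hhi : hi ≤ L + 1)
    {v : Fin n → (chainNet m L b).Node} {w : Fin n → (chainNet m L b').Node}
    (h : ∀ i, Matched lo hi (v i) (w i))
    (s : (netVocabulary m 1).toLanguage.Term (Fin n)) :
    Matched (m := m) (L := L) lo hi
      (FirstOrder.Language.Term.realize (M := (chainNet m L b).Node) v s)
      (FirstOrder.Language.Term.realize (M := (chainNet m L b').Node) w s) := by
  cases s with
  | var i => exact h i
  | func f ts =>
    cases f with
    | inp i => exact .inl ⟨Nat.zero_le _, rfl⟩
    | out j => exact .inr ⟨hhi, rfl⟩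

theorem atomEquiv_of_matched (b : Bool) {n : ℕ} (hlt : lo + 2 ≤ hi) (hhi : hi ≤ L + 1)
    {v : Fin n → (chainNet m L b).Node} {w : Fin n → (chainNet m L (!b)).Node}
    (h : ∀ i, Matched lo hi (v i) (w i)) : AtomEquiv (netVocabulary m 1) v w where
  eq_iff s₁ s₂ := Matched.eq_iff (lo := lo) (hi := hi) (by omega) (Matched.realize b (!b) hhi h s₁)
    (Matched.realize b (!b) hhi h s₂)
  rel_iff R s := by
    have hs := fun i => Matched.realize b (!b) hhi h (s i)
    cases R with
    | edge => exact Matched.edge_iff hlt hhi (hs 0) (hs 1)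
  wt_eq W s := by
    classical
    have hs := fun i => Matched.realize b (!b) hhi h (s i)
    cases W with
    | bias =>
      exact if_congr (hs 0).inp_iff rfl (congrArg _ ((hs 0).bias_eq hlt b))
    | weight =>
      exact if_congr (Matched.edge_iff hlt hhi (hs 0) (hs 1)) rfl rfl

theorem forall_snoc {A B : Type*} (R : A → B → Prop) {n : ℕ} {v : Fin n → A} {w : Fin n → B}
    {a : A} {b : B} (h : ∀ i, R (v i) (w i)) (hab : R a b) (i : Fin (n + 1)) :
    R (Fin.snoc (α := fun _ => A) v a i) (Fin.snoc (α := fun _ => B) w b i) := by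
  induction i using Fin.lastCases with
  | last => simpa using hab
  | cast i => simpa using h i

/-- A gap of `2 ^ (r + 1)` layers suffices for `r` rounds: exchanging the chains up to the middle of
the gap leaves half of it free, whichever node is chosen. -/
theorem bijEquiv_of_matched (b : Bool) {r lo hi n : ℕ} (hlt : lo + 2 ^ (r + 1) ≤ hi)
    (hhi : hi ≤ L + 1) {v : Fin n → (chainNet m L b).Node} {w : Fin n → (chainNet m L (!b)).Node}
    (h : ∀ i, Matched lo hi (v i) (w i)) : BijEquiv (netVocabulary m 1) r v w := by
  have hgap : lo + 2 ≤ hi := by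
    have : 2 ^ 1 ≤ 2 ^ (r + 1) := Nat.pow_le_pow_right (by norm_num) (by omega)
    omega
  induction r generalizing lo hi n with
  | zero => exact atomEquiv_of_matched b hgap hhi h
  | succ r ih =>
    have hpow : 2 ^ (r + 1 + 1) = 2 ^ (r + 1) + 2 ^ (r + 1) := by ring
    have hpos : 2 ^ 1 ≤ 2 ^ (r + 1) := Nat.pow_le_pow_right (by norm_num) (by omega)
    refine ⟨atomEquiv_of_matched b hgap hhi h, ChainNode.flipUpTo (lo + 2 ^ (r + 1)),
      fun (a : ChainNode m L) => ?_⟩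
    have extend : ∀ {lo' hi' : ℕ}, lo ≤ lo' → hi' ≤ hi →
        Matched lo' hi' a (ChainNode.flipUpTo (lo + 2 ^ (r + 1)) a) →
        ∀ i, Matched (m := m) (L := L) lo' hi'
          (Fin.snoc (α := fun _ => (chainNet m L b).Node) v a i)
          (Fin.snoc (α := fun _ => (chainNet m L (!b)).Node) w
            (ChainNode.flipUpTo (lo + 2 ^ (r + 1)) a) i) := fun h₁ h₂ ha =>
      forall_snoc _ (fun i => (h i).mono h₁ h₂) ha
    by_cases hc : a.layer ≤ lo + 2 ^ (r + 1)
    · refine ih (lo := lo + 2 ^ (r + 1)) (hi := hi) (by omega) hhi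
        (extend (by omega) le_rfl (.inl ⟨hc, if_pos hc⟩)) (by omega)
    · refine ih (lo := lo) (hi := lo + 2 ^ (r + 1) + 1) (by omega) (by omega)
        (extend le_rfl (by omega) (.inr ⟨by omega, if_neg hc⟩)) (by omega)

end Strategy

theorem realModels_zeroAtZero {m : ℕ} (f : (Fin m → ℝ) → ℝ) :
    RealModels f (zeroAtZero m) ↔ f 0 = 0 := by
  let := realStructure f
  have h : RealModels f (zeroAtZero m) ↔ f (fun _ => 0) = 0 := by
    unfold RealModels zeroAtZero FirstOrder.Language.Sentence.Realize
      FirstOrder.Language.Formula.Realize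
    exact FirstOrder.Language.Formula.realize_equal
  exact h

end FOSum

theorem corollary6 (m : ℕ) (hm : 1 ≤ m) :
    ¬ FOSum.ExpressibleInFOSum (FOSum.zeroAtZero m) := by
  rintro ⟨φ, hφ⟩
  obtain ⟨r, hr⟩ := φ.exists_rounds
  have key : ∀ b, FOSum.Models (FOSum.chainNet m (2 ^ (r + 1)) b).Node φ ↔
      (if true = b then (1 : ℝ) else 0) = 0 := fun b => by
    rw [← hφ _ (Nat.le_add_left 1 _) _ (FOSum.chainNet_mem_layeredNets m _ b),
      FOSum.realModels_zeroAtZero, FOSum.chainNet_func_zero b Nat.one_le_two_pow]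
  have hiff : FOSum.Models (FOSum.chainNet m (2 ^ (r + 1)) true).Node φ ↔
      FOSum.Models (FOSum.chainNet m (2 ^ (r + 1)) false).Node φ :=
    hr _ _ _ _ (FOSum.bijEquiv_of_matched true (lo := 0) (hi := 2 ^ (r + 1) + 1) (by omega) le_rfl
      fun i => i.elim0)
  rw [key, key] at hiff
  simp at hiff
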